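/- Let $\mathcal L$ be a set of propositional letters (possibly empty). The free bicartesian category $\mathcal C$ generated by $\mathcal L$ has as objects the formulae built from $\mathcal L$ and the constants $\mathrm I,\mathrm O$ with the binary connectives $\times,+$. Its arrows are terms modulo provable equality. Terms are built from $\mathbf 1_A:A\to A$, $k_A:A\to\mathrm I$, $l_A:\mathrm O\to A$ by composition and the operations $K^1_Bf:A\times B\to C$ (for $f:A\to C$), $K^2_Af:A\times B\to C$ (for $f:B\to C$), $L^1_Bf:C\to A+B$ (for $f:C\to A$), $L^2_Af:C\to A+B$ (for $f:C\to B$), $\langle f,g\rangle:C\to A\times B$ (for $f:C\to A$, $g:C\to B$) and $[f,g]:A+B\to C$ (for $f:A\to C$, $g:B\to C$). Provable equality is the least congruence containing the category laws, the equations $g\circ K^if=K^i(g\circ f)$, $K^ig\circ\langle f_1,f_2\rangle=g\circ f_i$, $\langle g_1,g_2\rangle\circ f=\langle g_1\circ f,g_2\circ f\rangle$, $\langle K^1_B\mathbf 1_A,K^2_A\mathbf 1_B\rangle=\mathbf 1_{A\times B}$, their duals for $L^i$ and $[\,,]$, and $f=k_A$ for every $f:A\to\mathrm I$, $f=l_A$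 for every $f:\mathrm O\to A$. The free category with binary products and sums $\mathcal C_{\times,+}$ is defined in the same way without $\mathrm I$, $\mathrm O$, $k_A$, $l_A$ and the last two families of equations; its terms are called $\times,+$-terms. The free distributive bicartesian category $\mathcal D$ is obtained from the calculus of $\mathcal C$ by adding inverses of the canonical arrows $(A\times B)+(A\times C)\to A\times(B+C)$ and making $\mathrm O\to A\times\mathrm O$ an isomorphism. The free bicartesian closed category $\mathcal H$ is obtained from the calculus of $\mathcal C$ by adding exponentials $B^A$ with evaluation, currying and the $\beta$ and $\eta$ equations. A category is a preorder if any two arrows with the same source and the same target are equal. (1) The functor $\mathcal C_{\times,+}\to\mathcal C$ that sends formulae and terms to themselves is well defined, full, faithful and injective on objects, and its image on objects consists exactly of the formulae containing neither $\mathrm I$ nor $\mathrm O$. Thus $\mathcal C_{\times,+}$ is a full subcategory of $\mathcal C$. (2) Let $\mathcal B$ be any category with (chosen) binary products and binary sums that is not a preorder, and let $f,g:A\to B$ be $\times,+$-terms of the same type. Then $f=g$ holds in $\mathcal B$ (i.e. under every assignment of objects of $\mathcal B$ to the letters) if and only if $f=g$ holds in $\mathcal C_{\times,+}$. (3) None of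 $\mathcal C$, $\mathcal D$, $\mathcal H$ is a preorder, and for all $\times,+$-terms $f,g:A\to B$, each of these three categories satisfies $f=g$ if and only if $f=g$ holds in $\mathcal C_{\times,+}$. -/

import Mathlib

open CategoryTheory CategoryTheory.Limits

universe w v u

namespace Bicart

/-- The four calculi in play: binary products and sums only; bicartesian (binary products and
sums, terminal and initial object); distributive bicartesian; bicartesian closed. -/
inductive Calculus
  | timesPlus
  | bicartesian
  | distributive
  | closed

/-- The calculus has the propositional constants `I` and `O`. -/
def Calculus.HasUnits : Calculus → Prop
  | .timesPlus => False
  | .bicartesian => True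
  | .distributive => True
  | .closed => True

/-- The calculus has distributivity of products over finite sums. -/
def Calculus.HasDistrib : Calculus → Prop
  | .timesPlus => False
  | .bicartesian => False
  | .distributive => True
  | .closed => False

/-- The calculus has exponentials. -/
def Calculus.HasExp : Calculus → Prop
  | .timesPlus => False
  | .bicartesian => False
  | .distributive => False
  | .closed => True

/-- Formulae over a set `L` of propositional letters. The constants `I`, `O` and the exponential
are available only in the calculi that have them; `exp A B` is the exponential `B ^ A`. -/
inductive Formula (c : Calculus) (L : Type w) : Type w
  | letter (p : L) : Formula c L
  | one (h : c.HasUnits) : Formula c L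
  | zero (h : c.HasUnits) : Formula c L
  | prod (A B : Formula c L) : Formula c L
  | sum (A B : Formula c L) : Formula c L
  | exp (h : c.HasExp) (A B : Formula c L) : Formula c L

open Formula

/-- Arrow terms; `Term A B` is the type of the terms `A → B`.  `comp g f` is `g ∘ f`. -/
inductive Term {c : Calculus} {L : Type w} : Formula c L → Formula c L → Type w
  | id (A : Formula c L) : Term A A
  | comp {A B C : Formula c L} (g : Term B C) (f : Term A B) : Term A C
  | K1 {A C : Formula c L} (B : Formula c L) (f : Term A C) : Term (prod A B) C
  | K2 {B C : Formula c L} (A : Formula c L) (f : Term B C) : Term (prod A B) C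
  | L1 {A C : Formula c L} (B : Formula c L) (f : Term C A) : Term C (sum A B)
  | L2 {B C : Formula c L} (A : Formula c L) (f : Term C B) : Term C (sum A B)
  | pair {A B C : Formula c L} (f : Term C A) (g : Term C B) : Term C (prod A B)
  | copair {A B C : Formula c L} (f : Term A C) (g : Term B C) : Term (sum A B) C
  | k (h : c.HasUnits) (A : Formula c L) : Term A (one h)
  | l (h : c.HasUnits) (A : Formula c L) : Term (zero h) A
  | dist (h : c.HasDistrib) (A B C : Formula c L) :
      Term (prod A (sum B C)) (sum (prod A B) (prod A C))
  | ev (h : c.HasExp) (A B : Formula c L) : Term (prod A (exp h A B)) B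
  | cur (h : c.HasExp) {A B C : Formula c L} (f : Term (prod A C) B) : Term C (exp h A B)

namespace Term

/-- The canonical arrow `(A × B) + (A × C) → A × (B + C)`. -/
def undist {c : Calculus} {L : Type w} (A B C : Formula c L) :
    Term (sum (prod A B) (prod A C)) (prod A (sum B C)) :=
  copair (pair (K1 B (id A)) (K2 A (L1 C (id B)))) (pair (K1 C (id A)) (K2 A (L2 B (id C))))

end Term

open Term

/-- Provable equality of arrow terms: the least congruence containing the equations of the
calculus. -/
inductive Eqn {c : Calculus} {L : Type w} :
    {A B : Formula c L} → Term A B → Term A B → Prop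
  -- equivalence relation
  | refl {A B : Formula c L} (f : Term A B) : Eqn f f
  | symm {A B : Formula c L} {f g : Term A B} : Eqn f g → Eqn g f
  | trans {A B : Formula c L} {f g h : Term A B} : Eqn f g → Eqn g h → Eqn f h
  -- congruence
  | comp_congr {A B C : Formula c L} {g g' : Term B C} {f f' : Term A B} :
      Eqn g g' → Eqn f f' → Eqn (comp g f) (comp g' f')
  | K1_congr {A C : Formula c L} (B : Formula c L) {f f' : Term A C} :
      Eqn f f' → Eqn (K1 B f) (K1 B f')
  | K2_congr {B C : Formula c L} (A : Formula c L) {f f' : Term B C} :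
      Eqn f f' → Eqn (K2 A f) (K2 A f')
  | L1_congr {A C : Formula c L} (B : Formula c L) {f f' : Term C A} :
      Eqn f f' → Eqn (L1 B f) (L1 B f')
  | L2_congr {B C : Formula c L} (A : Formula c L) {f f' : Term C B} :
      Eqn f f' → Eqn (L2 A f) (L2 A f')
  | pair_congr {A B C : Formula c L} {f f' : Term C A} {g g' : Term C B} :
      Eqn f f' → Eqn g g' → Eqn (pair f g) (pair f' g')
  | copair_congr {A B C : Formula c L} {f f' : Term A C} {g g' : Term B C} :
      Eqn f f' → Eqn g g' → Eqn (copair f g) (copair f' g')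
  | cur_congr (h : c.HasExp) {A B C : Formula c L} {f f' : Term (prod A C) B} :
      Eqn f f' → Eqn (cur h f) (cur h f')
  -- category
  | id_comp {A B : Formula c L} (f : Term A B) : Eqn (comp (id B) f) f
  | comp_id {A B : Formula c L} (f : Term A B) : Eqn (comp f (id A)) f
  | assoc {A B C D : Formula c L} (h : Term C D) (g : Term B C) (f : Term A B) :
      Eqn (comp h (comp g f)) (comp (comp h g) f)
  -- binary products
  | comp_K1 {A C D : Formula c L} (B : Formula c L) (g : Term C D) (f : Term A C) :
      Eqn (comp g (K1 B f)) (K1 B (comp g f))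
  | comp_K2 {B C D : Formula c L} (A : Formula c L) (g : Term C D) (f : Term B C) :
      Eqn (comp g (K2 A f)) (K2 A (comp g f))
  | K1_pair {A B C D : Formula c L} (g : Term A D) (f₁ : Term C A) (f₂ : Term C B) :
      Eqn (comp (K1 B g) (pair f₁ f₂)) (comp g f₁)
  | K2_pair {A B C D : Formula c L} (g : Term B D) (f₁ : Term C A) (f₂ : Term C B) :
      Eqn (comp (K2 A g) (pair f₁ f₂)) (comp g f₂)
  | pair_comp {A B C D : Formula c L} (g₁ : Term C A) (g₂ : Term C B) (f : Term D C) :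
      Eqn (comp (pair g₁ g₂) f) (pair (comp g₁ f) (comp g₂ f))
  | pair_eta (A B : Formula c L) : Eqn (pair (K1 B (id A)) (K2 A (id B))) (id (prod A B))
  -- binary sums
  | L1_comp {A C D : Formula c L} (B : Formula c L) (g : Term C A) (f : Term D C) :
      Eqn (comp (L1 B g) f) (L1 B (comp g f))
  | L2_comp {B C D : Formula c L} (A : Formula c L) (g : Term C B) (f : Term D C) :
      Eqn (comp (L2 A g) f) (L2 A (comp g f))
  | copair_L1 {A B C D : Formula c L} (g₁ : Term A C) (g₂ : Term B C) (f : Term D A) :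
      Eqn (comp (copair g₁ g₂) (L1 B f)) (comp g₁ f)
  | copair_L2 {A B C D : Formula c L} (g₁ : Term A C) (g₂ : Term B C) (f : Term D B) :
      Eqn (comp (copair g₁ g₂) (L2 A f)) (comp g₂ f)
  | comp_copair {A B C D : Formula c L} (g : Term C D) (f₁ : Term A C) (f₂ : Term B C) :
      Eqn (comp g (copair f₁ f₂)) (copair (comp g f₁) (comp g f₂))
  | copair_eta (A B : Formula c L) : Eqn (copair (L1 B (id A)) (L2 A (id B))) (id (sum A B))
  -- terminal and initial object
  | k_eta (h : c.HasUnits) {A : Formula c L} (f : Term A (one h)) : Eqn f (k h A)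
  | l_eta (h : c.HasUnits) {A : Formula c L} (f : Term (zero h) A) : Eqn f (l h A)
  -- distributivity: `undist` and `O → A × O` are isomorphisms
  | dist_undist (h : c.HasDistrib) (A B C : Formula c L) :
      Eqn (comp (dist h A B C) (undist A B C)) (id (sum (prod A B) (prod A C)))
  | undist_dist (h : c.HasDistrib) (A B C : Formula c L) :
      Eqn (comp (undist A B C) (dist h A B C)) (id (prod A (sum B C)))
  | dist_zero (_h : c.HasDistrib) (hu : c.HasUnits) (A : Formula c L) :
      Eqn (comp (l hu (prod A (zero hu))) (K2 A (id (zero hu)))) (id (prod A (zero hu)))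
  -- exponentials
  | beta (h : c.HasExp) {A B C : Formula c L} (f : Term (prod A C) B) :
      Eqn (comp (ev h A B) (pair (K1 C (id A)) (K2 A (cur h f)))) f
  | eta (h : c.HasExp) {A B C : Formula c L} (g : Term C (exp h A B)) :
      Eqn (cur h (comp (ev h A B) (pair (K1 C (id A)) (K2 A g)))) g

/-- Provable equality as a setoid on the terms of a given type. -/
def termSetoid {c : Calculus} {L : Type w} (A B : Formula c L) : Setoid (Term A B) where
  r := Eqn
  iseqv := ⟨Eqn.refl, Eqn.symm, Eqn.trans⟩

/-- The objects of the free category of the given calculus generated by `L`. -/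
def Free (c : Calculus) (L : Type w) : Type w := Formula c L

/-- The free category of the given calculus generated by `L`: objects are formulae, arrows are
terms modulo provable equality. -/
instance Free.category (c : Calculus) (L : Type w) : Category.{w} (Free c L) where
  Hom A B := Quotient (termSetoid (c := c) (L := L) A B)
  id A := Quotient.mk _ (Term.id (c := c) (L := L) A)
  comp f g := Quotient.map₂ (fun f g => Term.comp g f)
    (fun _ _ hf _ _ hg => Eqn.comp_congr hg hf) f g
  id_comp f := Quotient.inductionOn f fun f => Quotient.sound (Eqn.comp_id f)
  comp_id f := Quotient.inductionOn f fun f => Quotient.sound (Eqn.id_comp f)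
  assoc f g h := Quotient.inductionOn₃ f g h fun f g h => Quotient.sound (Eqn.assoc h g f)

/-- Formulae built from letters with `×` and `+` only. -/
def Formula.IsTimesPlus {c : Calculus} {L : Type w} : Formula c L → Prop
  | .letter _ => True
  | .one _ => False
  | .zero _ => False
  | .prod A B => A.IsTimesPlus ∧ B.IsTimesPlus
  | .sum A B => A.IsTimesPlus ∧ B.IsTimesPlus
  | .exp _ _ _ => False

/-- A `×,+`-formula, read as a formula of the calculus `c`. -/
def Formula.incl (c : Calculus) {L : Type w} : Formula .timesPlus L → Formula c L
  | .letter p => .letter p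
  | .one h => h.elim
  | .zero h => h.elim
  | .prod A B => .prod (A.incl c) (B.incl c)
  | .sum A B => .sum (A.incl c) (B.incl c)
  | .exp h _ _ => h.elim

/-- A `×,+`-term, read as a term of the calculus `c`. -/
def Term.incl (c : Calculus) {L : Type w} :
    {A B : Formula .timesPlus L} → Term A B → Term (A.incl c) (B.incl c)
  | _, _, .id A => .id (A.incl c)
  | _, _, .comp g f => .comp (g.incl c) (f.incl c)
  | _, _, .K1 B f => .K1 (B.incl c) (f.incl c)
  | _, _, .K2 A f => .K2 (A.incl c) (f.incl c)
  | _, _, .L1 B f => .L1 (B.incl c) (f.incl c)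
  | _, _, .L2 A f => .L2 (A.incl c) (f.incl c)
  | _, _, .pair f g => .pair (f.incl c) (g.incl c)
  | _, _, .copair f g => .copair (f.incl c) (g.incl c)
  | _, _, .k h _ => h.elim
  | _, _, .l h _ => h.elim
  | _, _, .dist h _ _ _ => h.elim
  | _, _, .ev h _ _ => h.elim
  | _, _, .cur h _ => h.elim

theorem Eqn.incl (c : Calculus) {L : Type w} {A B : Formula .timesPlus L} {f g : Term A B}
    (e : Eqn f g) : Eqn (f.incl c) (g.incl c) := by
  induction e with
  | refl f => exact .refl _
  | symm _ ih => exact .symm ih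
  | trans _ _ ih₁ ih₂ => exact .trans ih₁ ih₂
  | comp_congr _ _ ih₁ ih₂ => exact .comp_congr ih₁ ih₂
  | K1_congr B _ ih => exact .K1_congr _ ih
  | K2_congr A _ ih => exact .K2_congr _ ih
  | L1_congr B _ ih => exact .L1_congr _ ih
  | L2_congr A _ ih => exact .L2_congr _ ih
  | pair_congr _ _ ih₁ ih₂ => exact .pair_congr ih₁ ih₂
  | copair_congr _ _ ih₁ ih₂ => exact .copair_congr ih₁ ih₂
  | cur_congr h => exact h.elim
  | id_comp f => exact .id_comp _
  | comp_id f => exact .comp_id _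
  | assoc h g f => exact .assoc _ _ _
  | comp_K1 B g f => exact .comp_K1 _ _ _
  | comp_K2 A g f => exact .comp_K2 _ _ _
  | K1_pair g f₁ f₂ => exact .K1_pair _ _ _
  | K2_pair g f₁ f₂ => exact .K2_pair _ _ _
  | pair_comp g₁ g₂ f => exact .pair_comp _ _ _
  | pair_eta A B => exact .pair_eta _ _
  | L1_comp B g f => exact .L1_comp _ _ _
  | L2_comp A g f => exact .L2_comp _ _ _
  | copair_L1 g₁ g₂ f => exact .copair_L1 _ _ _
  | copair_L2 g₁ g₂ f => exact .copair_L2 _ _ _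
  | comp_copair g f₁ f₂ => exact .comp_copair _ _ _
  | copair_eta A B => exact .copair_eta _ _
  | k_eta h => exact h.elim
  | l_eta h => exact h.elim
  | dist_undist h => exact h.elim
  | undist_dist h => exact h.elim
  | dist_zero h => exact h.elim
  | beta h => exact h.elim
  | eta h => exact h.elim

/-- The functor from the free category with binary products and sums to the free category of the
calculus `c` that sends formulae and (classes of) terms to themselves. -/
def inclusion (c : Calculus) (L : Type w) : Free .timesPlus L ⥤ Free c L where
  obj A := Formula.incl (L := L) c A
  map f := Quotient.map (Term.incl c) (fun _ _ e => Eqn.incl c e) f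
  map_id _ := rfl
  map_comp f g := Quotient.inductionOn₂ f g fun _ _ => rfl

/-- A choice of binary products and binary sums in a category. -/
structure BinaryProductsSums (𝓑 : Type u) [Category.{v} 𝓑] where
  prod : ∀ X Y : 𝓑, LimitCone (Limits.pair X Y)
  sum : ∀ X Y : 𝓑, ColimitCocone (Limits.pair X Y)

namespace BinaryProductsSums

variable {𝓑 : Type u} [Category.{v} 𝓑] (S : BinaryProductsSums 𝓑)

def prodObj (X Y : 𝓑) : 𝓑 := (S.prod X Y).cone.pt

def sumObj (X Y : 𝓑) : 𝓑 := (S.sum X Y).cocone.pt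

def fst (X Y : 𝓑) : S.prodObj X Y ⟶ X := BinaryFan.fst (S.prod X Y).cone

def snd (X Y : 𝓑) : S.prodObj X Y ⟶ Y := BinaryFan.snd (S.prod X Y).cone

def inl (X Y : 𝓑) : X ⟶ S.sumObj X Y := BinaryCofan.inl (S.sum X Y).cocone

def inr (X Y : 𝓑) : Y ⟶ S.sumObj X Y := BinaryCofan.inr (S.sum X Y).cocone

def lift {X Y Z : 𝓑} (f : Z ⟶ X) (g : Z ⟶ Y) : Z ⟶ S.prodObj X Y :=
  (S.prod X Y).isLimit.lift (BinaryFan.mk f g)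

def desc {X Y Z : 𝓑} (f : X ⟶ Z) (g : Y ⟶ Z) : S.sumObj X Y ⟶ Z :=
  (S.sum X Y).isColimit.desc (BinaryCofan.mk f g)

/-- The object denoted by a `×,+`-formula when the letters denote the objects `a p`. -/
def obj {L : Type w} (a : L → 𝓑) : Formula .timesPlus L → 𝓑
  | .letter p => a p
  | .one h => h.elim
  | .zero h => h.elim
  | .prod A B => S.prodObj (obj a A) (obj a B)
  | .sum A B => S.sumObj (obj a A) (obj a B)
  | .exp h _ _ => h.elim

/-- The arrow denoted by a `×,+`-term when the letters denote the objects `a p`. -/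
def arrow {L : Type w} (a : L → 𝓑) :
    {A B : Formula .timesPlus L} → Term A B → (S.obj a A ⟶ S.obj a B)
  | _, _, .id A => 𝟙 (S.obj a A)
  | _, _, .comp g f => arrow a f ≫ arrow a g
  | _, _, .K1 _ f => S.fst _ _ ≫ arrow a f
  | _, _, .K2 _ f => S.snd _ _ ≫ arrow a f
  | _, _, .L1 _ f => arrow a f ≫ S.inl _ _
  | _, _, .L2 _ f => arrow a f ≫ S.inr _ _
  | _, _, .pair f g => S.lift (arrow a f) (arrow a g)
  | _, _, .copair f g => S.desc (arrow a f) (arrow a g)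
  | _, _, .k h _ => h.elim
  | _, _, .l h _ => h.elim
  | _, _, .dist h _ _ _ => h.elim
  | _, _, .ev h _ _ => h.elim
  | _, _, .cur h _ => h.elim

/-- The equation `f = g` holds in `𝓑`, the letters being variables for arbitrary objects. -/
def Holds {L : Type w} {A B : Formula .timesPlus L} (f g : Term A B) : Prop :=
  ∀ a : L → 𝓑, S.arrow a f = S.arrow a g

end BinaryProductsSums

end Bicart

/-! Fullness rests on cut elimination. In the calculi without distributivity and exponentials every
term equals one without composition and with identities on letters only. The types inside such a
term are subformulae of its source and target, so between `×,+`-formulae neither `k` nor `l` can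
occur.

The core is maximality (`holds_iff_eqn`): a category `𝓑` with binary products and sums that is not a
preorder satisfies only provable equations. Distinct parallel arrows `X → Y` force the two
injections `X → X + X` to differ, and the two projections `Y × Y → Y`. Let every letter denote one
object `X`. Each formula then has points `X → A` and copoints `A → X`, and any point followed by any
copoint is the identity. Hence projections are split epi and injections split mono, so `K1`, `K2`,
`L1`, `L2` can be cancelled, and the arrow denoted by a term determines into which summand the term
sends each point, and dually for copoints.

Provability then follows by induction on the source and the target. A sum in the source or a product
in the target is removed by its universal property. The critical case is `K1 f = L1 g` from a
product to a sum: all points go to the left summand and all copoints come from the left factor, so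
`f` factors through `L1` and `g` through `K1`; both operations are cancelled and the induction
hypothesis applies.

Sets form such a category, and all four calculi are sound in sets. So a `×,+`-equation provable in
any of them holds in sets and is provable from products and sums alone; this gives faithfulness and
conservativity. -/

namespace Bicart

open Formula Term

/-! ### Cut elimination -/

section CutElimination

variable {c : Calculus} {L : Type w}

/-- Terms without composition and with identities on letters only. -/
inductive Term.CutFree : {A B : Formula c L} → Term A B → Prop
  | id (p : L) : CutFree (Term.id (letter p))
  | K1 {A C : Formula c L} (B : Formula c L) {f : Term A C} : CutFree f → CutFree (K1 B f)
  | K2 {B C : Formula c L} (A : Formula c L) {f : Term B C} : CutFree f → CutFree (K2 A f)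
  | L1 {A C : Formula c L} (B : Formula c L) {f : Term C A} : CutFree f → CutFree (L1 B f)
  | L2 {B C : Formula c L} (A : Formula c L) {f : Term C B} : CutFree f → CutFree (L2 A f)
  | pair {A B C : Formula c L} {f : Term C A} {g : Term C B} :
      CutFree f → CutFree g → CutFree (pair f g)
  | copair {A B C : Formula c L} {f : Term A C} {g : Term B C} :
      CutFree f → CutFree g → CutFree (copair f g)
  | k (h : c.HasUnits) (A : Formula c L) : CutFree (k h A)
  | l (h : c.HasUnits) (A : Formula c L) : CutFree (l h A)

/-- Terms provably equal to a cut-free term. -/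
def Term.Reducible {A B : Formula c L} (f : Term A B) : Prop := ∃ h, CutFree h ∧ Eqn f h

theorem Term.CutFree.reducible {A B : Formula c L} {f : Term A B} (hf : f.CutFree) :
    f.Reducible := ⟨f, hf, .refl f⟩

namespace Term.Reducible

variable {A B C : Formula c L}

theorem of_eqn {f g : Term A B} (e : Eqn f g) : g.Reducible → f.Reducible
  | ⟨h, hh, e'⟩ => ⟨h, hh, e.trans e'⟩

theorem K1 {f : Term A C} : f.Reducible → (K1 B f).Reducible
  | ⟨_, hh, e⟩ => ⟨_, hh.K1 B, e.K1_congr B⟩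

theorem K2 {f : Term B C} : f.Reducible → (K2 A f).Reducible
  | ⟨_, hh, e⟩ => ⟨_, hh.K2 A, e.K2_congr A⟩

theorem L1 {f : Term C A} : f.Reducible → (L1 B f).Reducible
  | ⟨_, hh, e⟩ => ⟨_, hh.L1 B, e.L1_congr B⟩

theorem L2 {f : Term C B} : f.Reducible → (L2 A f).Reducible
  | ⟨_, hh, e⟩ => ⟨_, hh.L2 A, e.L2_congr A⟩

theorem pair {f : Term C A} {g : Term C B} : f.Reducible → g.Reducible → (pair f g).Reducible
  | ⟨_, hh, e⟩, ⟨_, hh', e'⟩ => ⟨_, hh.pair hh', e.pair_congr e'⟩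

theorem copair {f : Term A C} {g : Term B C} :
    f.Reducible → g.Reducible → (copair f g).Reducible
  | ⟨_, hh, e⟩, ⟨_, hh', e'⟩ => ⟨_, hh.copair hh', e.copair_congr e'⟩

end Term.Reducible

/-- Composition with cut-free terms after `f` is eliminable. -/
def Term.Cuttable {A B : Formula c L} (f : Term A B) : Prop :=
  ∀ {C : Formula c L} {g : Term B C}, g.CutFree → (comp g f).Reducible

namespace Term.Cuttable

variable {A B C : Formula c L}

/-- Induction on the cut-free term `g` that follows. If `g` ends in a projection, the cut passes to
one component, where `h₁` or `h₂` applies; otherwise `g` ends in an operation on its target, which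
moves outside the composition. Identities on letters only leave no further case. The two lemmas on
injections follow the same pattern. -/
theorem comp_pair {f₁ : Term A B} {f₂ : Term A C} (h₁ : f₁.Cuttable) (h₂ : f₂.Cuttable) :
    (Term.pair f₁ f₂).Cuttable
  | _, _, .K1 _ hg => .of_eqn (.K1_pair _ _ _) (h₁ hg)
  | _, _, .K2 _ hg => .of_eqn (.K2_pair _ _ _) (h₂ hg)
  | _, _, .L1 _ hg => .of_eqn (.L1_comp _ _ _) (.L1 (comp_pair h₁ h₂ hg))
  | _, _, .L2 _ hg => .of_eqn (.L2_comp _ _ _) (.L2 (comp_pair h₁ h₂ hg))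
  | _, _, .pair hg hg' =>
    .of_eqn (.pair_comp _ _ _) (.pair (comp_pair h₁ h₂ hg) (comp_pair h₁ h₂ hg'))
  | _, _, .k h _ => .of_eqn (.k_eta h _) (CutFree.k h _).reducible

theorem comp_L1 {f : Term A B} (hf : f.Cuttable) : (Term.L1 C f).Cuttable
  | _, _, .copair hg _ => .of_eqn (.copair_L1 _ _ _) (hf hg)
  | _, _, .L1 _ hg => .of_eqn (.L1_comp _ _ _) (.L1 (comp_L1 hf hg))
  | _, _, .L2 _ hg => .of_eqn (.L2_comp _ _ _) (.L2 (comp_L1 hf hg))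
  | _, _, .pair hg hg' => .of_eqn (.pair_comp _ _ _) (.pair (comp_L1 hf hg) (comp_L1 hf hg'))
  | _, _, .k h _ => .of_eqn (.k_eta h _) (CutFree.k h _).reducible

theorem comp_L2 {f : Term A C} (hf : f.Cuttable) : (Term.L2 B f).Cuttable
  | _, _, .copair _ hg => .of_eqn (.copair_L2 _ _ _) (hf hg)
  | _, _, .L1 _ hg => .of_eqn (.L1_comp _ _ _) (.L1 (comp_L2 hf hg))
  | _, _, .L2 _ hg => .of_eqn (.L2_comp _ _ _) (.L2 (comp_L2 hf hg))
  | _, _, .pair hg hg' => .of_eqn (.pair_comp _ _ _) (.pair (comp_L2 hf hg) (comp_L2 hf hg'))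
  | _, _, .k h _ => .of_eqn (.k_eta h _) (CutFree.k h _).reducible

theorem comp_k (h : c.HasUnits) : (Term.k h A).Cuttable
  | _, _, .L1 _ hg => .of_eqn (.L1_comp _ _ _) (.L1 (comp_k h hg))
  | _, _, .L2 _ hg => .of_eqn (.L2_comp _ _ _) (.L2 (comp_k h hg))
  | _, _, .pair hg hg' => .of_eqn (.pair_comp _ _ _) (.pair (comp_k h hg) (comp_k h hg'))
  | _, _, .k h _ => .of_eqn (.k_eta h _) (CutFree.k h _).reducible

end Term.Cuttable

/-- Outer induction, on the first factor `f`. If `f` ends in an operation on its source, that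
operation moves outside whatever `g` is; if it ends in an operation on its target, the inner
inductions on `g` above take over. -/
theorem Term.CutFree.cuttable {A B : Formula c L} {f : Term A B} (hf : f.CutFree) :
    f.Cuttable := by
  induction hf with
  | id p => exact fun hg => .of_eqn (.comp_id _) hg.reducible
  | K1 B _ ih => exact fun hg => .of_eqn (.comp_K1 _ _ _) (.K1 (ih hg))
  | K2 A _ ih => exact fun hg => .of_eqn (.comp_K2 _ _ _) (.K2 (ih hg))
  | L1 B _ ih => exact Cuttable.comp_L1 ih
  | L2 B _ ih => exact Cuttable.comp_L2 ih
  | pair _ _ ih₁ ih₂ => exact Cuttable.comp_pair ih₁ ih₂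
  | copair _ _ ih₁ ih₂ =>
    exact fun hg => .of_eqn (.comp_copair _ _ _) (.copair (ih₁ hg) (ih₂ hg))
  | k h A => exact Cuttable.comp_k h
  | l h A => exact fun _ => .of_eqn (.l_eta h _) (CutFree.l h _).reducible

/-- The `η` equations expand an identity down to the letters. Exponentials are excluded because no
cut-free operation introduces them. -/
theorem Term.reducible_id (he : ¬ c.HasExp) : ∀ A : Formula c L, (Term.id A).Reducible
  | .letter p => (CutFree.id p).reducible
  | .one h => .of_eqn (.k_eta h _) (CutFree.k h _).reducible
  | .zero h => .of_eqn (.l_eta h _) (CutFree.l h _).reducible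
  | .prod A B => .of_eqn (.symm (.pair_eta A B))
      (.pair (.K1 (reducible_id he A)) (.K2 (reducible_id he B)))
  | .sum A B => .of_eqn (.symm (.copair_eta A B))
      (.copair (.L1 (reducible_id he A)) (.L2 (reducible_id he B)))
  | .exp h _ _ => absurd h he

/-- Cut elimination. -/
theorem Term.reducible (hd : ¬ c.HasDistrib) (he : ¬ c.HasExp) {A B : Formula c L}
    (f : Term A B) : f.Reducible := by
  induction f with
  | id A => exact reducible_id he A
  | comp g f ihg ihf =>
    obtain ⟨g', hg, eg⟩ := ihg
    obtain ⟨f', hf, ef⟩ := ihf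
    exact .of_eqn (.comp_congr eg ef) (hf.cuttable hg)
  | K1 B f ih => exact .K1 ih
  | K2 A f ih => exact .K2 ih
  | L1 B f ih => exact .L1 ih
  | L2 A f ih => exact .L2 ih
  | pair f g ihf ihg => exact .pair ihf ihg
  | copair f g ihf ihg => exact .copair ihf ihg
  | k h A => exact (CutFree.k h A).reducible
  | l h A => exact (CutFree.l h A).reducible
  | dist h => exact absurd h hd
  | ev h => exact absurd h he
  | cur h => exact absurd h he

end CutElimination

/-! ### Subformula property and fullness -/

section Fullness

variable {L : Type w}

theorem Formula.incl_injective (c : Calculus) :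
    ∀ A B : Formula .timesPlus L, A.incl c = B.incl c → A = B := by
  intro A
  induction A with
  | letter p => intro B h; cases B <;> simp_all [incl] <;> contradiction
  | one h => exact h.elim
  | zero h => exact h.elim
  | prod A₁ A₂ ih₁ ih₂ =>
    intro B h
    cases B <;> simp only [incl, Formula.prod.injEq, reduceCtorEq] at h
    · rename_i h'; exact h'.elim
    · rename_i h'; exact h'.elim
    · rw [ih₁ _ h.1, ih₂ _ h.2]
    · rename_i h' _ _; exact h'.elim
  | sum A₁ A₂ ih₁ ih₂ =>
    intro B h
    cases B <;> simp only [incl, Formula.sum.injEq, reduceCtorEq] at h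
    · rename_i h'; exact h'.elim
    · rename_i h'; exact h'.elim
    · rw [ih₁ _ h.1, ih₂ _ h.2]
    · rename_i h' _ _; exact h'.elim
  | exp h => exact h.elim

theorem Formula.isTimesPlus_incl (c : Calculus) :
    ∀ A : Formula .timesPlus L, (A.incl c).IsTimesPlus
  | .letter _ => trivial
  | .one h => h.elim
  | .zero h => h.elim
  | .prod A B => ⟨isTimesPlus_incl c A, isTimesPlus_incl c B⟩
  | .sum A B => ⟨isTimesPlus_incl c A, isTimesPlus_incl c B⟩
  | .exp h _ _ => h.elim

theorem Formula.IsTimesPlus.exists_incl {c : Calculus} :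
    ∀ {A : Formula c L}, A.IsTimesPlus → ∃ B : Formula .timesPlus L, B.incl c = A
  | .letter p, _ => ⟨.letter p, rfl⟩
  | .one _, h => h.elim
  | .zero _, h => h.elim
  | .prod _ _, ⟨h₁, h₂⟩ => by
    obtain ⟨B₁, rfl⟩ := exists_incl h₁
    obtain ⟨B₂, rfl⟩ := exists_incl h₂
    exact ⟨.prod B₁ B₂, rfl⟩
  | .sum _ _, ⟨h₁, h₂⟩ => by
    obtain ⟨B₁, rfl⟩ := exists_incl h₁
    obtain ⟨B₂, rfl⟩ := exists_incl h₂
    exact ⟨.sum B₁ B₂, rfl⟩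
  | .exp _ _ _, h => h.elim

theorem Formula.incl_eq_prod {c : Calculus} {A : Formula .timesPlus L} {B C : Formula c L}
    (h : A.incl c = .prod B C) : ∃ A₁ A₂, A = .prod A₁ A₂ ∧ A₁.incl c = B ∧ A₂.incl c = C := by
  cases A <;> simp_all [incl] <;> contradiction

theorem Formula.incl_eq_sum {c : Calculus} {A : Formula .timesPlus L} {B C : Formula c L}
    (h : A.incl c = .sum B C) : ∃ A₁ A₂, A = .sum A₁ A₂ ∧ A₁.incl c = B ∧ A₂.incl c = C := by
  cases A <;> simp_all [incl] <;> contradiction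

/-- Cut-free terms between `×,+`-formulae are `×,+`-terms. -/
theorem Term.CutFree.exists_incl {c : Calculus} {A' B' : Formula c L} {f : Term A' B'}
    (hf : f.CutFree) (A B : Formula .timesPlus L) (hA : A.incl c = A') (hB : B.incl c = B') :
    ∃ g : Term A B, HEq (g.incl c) f := by
  induction hf generalizing A B with
  | id p =>
    obtain rfl := incl_injective c A (.letter p) hA
    obtain rfl := incl_injective c B (.letter p) hB
    exact ⟨.id _, .rfl⟩
  | K1 _ _ ih =>
    obtain ⟨A₁, A₂, rfl, rfl, rfl⟩ := incl_eq_prod hA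
    subst hB
    obtain ⟨g, hg⟩ := ih _ _ rfl rfl
    -- With the endpoints substituted both sides have the same type, so the heterogeneous equality
    -- can be eliminated.
    cases hg
    exact ⟨.K1 _ g, .rfl⟩
  | K2 _ _ ih =>
    obtain ⟨A₁, A₂, rfl, rfl, rfl⟩ := incl_eq_prod hA
    subst hB
    obtain ⟨g, hg⟩ := ih _ _ rfl rfl
    cases hg
    exact ⟨.K2 _ g, .rfl⟩
  | L1 _ _ ih =>
    obtain ⟨B₁, B₂, rfl, rfl, rfl⟩ := incl_eq_sum hB
    subst hA
    obtain ⟨g, hg⟩ := ih _ _ rfl rfl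
    cases hg
    exact ⟨.L1 _ g, .rfl⟩
  | L2 _ _ ih =>
    obtain ⟨B₁, B₂, rfl, rfl, rfl⟩ := incl_eq_sum hB
    subst hA
    obtain ⟨g, hg⟩ := ih _ _ rfl rfl
    cases hg
    exact ⟨.L2 _ g, .rfl⟩
  | pair _ _ ih₁ ih₂ =>
    obtain ⟨B₁, B₂, rfl, rfl, rfl⟩ := incl_eq_prod hB
    subst hA
    obtain ⟨g₁, hg₁⟩ := ih₁ _ _ rfl rfl
    obtain ⟨g₂, hg₂⟩ := ih₂ _ _ rfl rfl
    cases hg₁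
    cases hg₂
    exact ⟨.pair g₁ g₂, .rfl⟩
  | copair _ _ ih₁ ih₂ =>
    obtain ⟨A₁, A₂, rfl, rfl, rfl⟩ := incl_eq_sum hA
    subst hB
    obtain ⟨g₁, hg₁⟩ := ih₁ _ _ rfl rfl
    obtain ⟨g₂, hg₂⟩ := ih₂ _ _ rfl rfl
    cases hg₁
    cases hg₂
    exact ⟨.copair g₁ g₂, .rfl⟩
  | k h _ =>
    have := isTimesPlus_incl c B
    rw [hB] at this
    exact this.elim
  | l h _ =>
    have := isTimesPlus_incl c A
    rw [hA] at this
    exact this.elim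

theorem inclusion_full (c : Calculus) (hd : ¬ c.HasDistrib) (he : ¬ c.HasExp) :
    (inclusion c L).Full where
  map_surjective {A B} f := by
    induction f using Quotient.inductionOn with
    | h f =>
      obtain ⟨h, hh, e⟩ := f.reducible hd he
      obtain ⟨g, hg⟩ := hh.exists_incl A B rfl rfl
      cases hg
      exact ⟨Quotient.mk _ g, Quotient.sound e.symm⟩

theorem inclusion_obj_injective (c : Calculus) : Function.Injective (inclusion c L).obj :=
  fun A B h => Formula.incl_injective c A B h

theorem range_inclusion_obj (c : Calculus) :
    Set.range (inclusion c L).obj = {A | Formula.IsTimesPlus (c := c) (L := L) A} := by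
  ext A
  constructor
  · rintro ⟨B, rfl⟩
    exact Formula.isTimesPlus_incl c B
  · intro h
    obtain ⟨B, hB⟩ := Formula.IsTimesPlus.exists_incl h
    exact ⟨B, hB⟩

end Fullness


/-! ### Soundness in a category with chosen binary products and sums -/

namespace BinaryProductsSums

variable {𝓑 : Type u} [Category.{v} 𝓑] (S : BinaryProductsSums 𝓑)

section UniversalProperties

variable {W X Y Z : 𝓑}

@[simp]
theorem lift_fst (f : Z ⟶ X) (g : Z ⟶ Y) : S.lift f g ≫ S.fst X Y = f :=
  (S.prod X Y).isLimit.fac (BinaryFan.mk f g) ⟨WalkingPair.left⟩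

@[simp]
theorem lift_snd (f : Z ⟶ X) (g : Z ⟶ Y) : S.lift f g ≫ S.snd X Y = g :=
  (S.prod X Y).isLimit.fac (BinaryFan.mk f g) ⟨WalkingPair.right⟩

@[simp]
theorem inl_desc (f : X ⟶ Z) (g : Y ⟶ Z) : S.inl X Y ≫ S.desc f g = f :=
  (S.sum X Y).isColimit.fac (BinaryCofan.mk f g) ⟨WalkingPair.left⟩

@[simp]
theorem inr_desc (f : X ⟶ Z) (g : Y ⟶ Z) : S.inr X Y ≫ S.desc f g = g :=
  (S.sum X Y).isColimit.fac (BinaryCofan.mk f g) ⟨WalkingPair.right⟩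

@[simp]
theorem lift_fst_assoc (f : Z ⟶ X) (g : Z ⟶ Y) (h : X ⟶ W) :
    S.lift f g ≫ S.fst X Y ≫ h = f ≫ h := by
  rw [← Category.assoc, lift_fst]

@[simp]
theorem lift_snd_assoc (f : Z ⟶ X) (g : Z ⟶ Y) (h : Y ⟶ W) :
    S.lift f g ≫ S.snd X Y ≫ h = g ≫ h := by
  rw [← Category.assoc, lift_snd]

@[simp]
theorem inl_desc_assoc (f : X ⟶ Z) (g : Y ⟶ Z) (h : Z ⟶ W) :
    S.inl X Y ≫ S.desc f g ≫ h = f ≫ h := by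
  rw [← Category.assoc, inl_desc]

@[simp]
theorem inr_desc_assoc (f : X ⟶ Z) (g : Y ⟶ Z) (h : Z ⟶ W) :
    S.inr X Y ≫ S.desc f g ≫ h = g ≫ h := by
  rw [← Category.assoc, inr_desc]

variable {S} in
theorem prod_hom_ext {f g : Z ⟶ S.prodObj X Y} (h₁ : f ≫ S.fst X Y = g ≫ S.fst X Y)
    (h₂ : f ≫ S.snd X Y = g ≫ S.snd X Y) : f = g :=
  BinaryFan.IsLimit.hom_ext (S.prod X Y).isLimit h₁ h₂

variable {S} in
theorem sum_hom_ext {f g : S.sumObj X Y ⟶ Z} (h₁ : S.inl X Y ≫ f = S.inl X Y ≫ g)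
    (h₂ : S.inr X Y ≫ f = S.inr X Y ≫ g) : f = g :=
  BinaryCofan.IsColimit.hom_ext (S.sum X Y).isColimit h₁ h₂

@[simp]
theorem comp_lift (h : W ⟶ Z) (f : Z ⟶ X) (g : Z ⟶ Y) :
    h ≫ S.lift f g = S.lift (h ≫ f) (h ≫ g) := by
  apply prod_hom_ext <;> simp

@[simp]
theorem desc_comp (f : X ⟶ Z) (g : Y ⟶ Z) (h : Z ⟶ W) :
    S.desc f g ≫ h = S.desc (f ≫ h) (g ≫ h) := by
  apply sum_hom_ext <;> simp

@[simp]
theorem lift_fst_snd : S.lift (S.fst X Y) (S.snd X Y) = 𝟙 _ := by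
  apply prod_hom_ext <;> simp

@[simp]
theorem desc_inl_inr : S.desc (S.inl X Y) (S.inr X Y) = 𝟙 _ := by
  apply sum_hom_ext <;> simp

end UniversalProperties

variable {L : Type w} {A B C : Formula .timesPlus L}

theorem arrow_eq_of_eqn (a : L → 𝓑) {f g : Term A B} (e : Eqn f g) :
    S.arrow a f = S.arrow a g := by
  induction e with
  | refl f => rfl
  | symm _ ih => exact ih.symm
  | trans _ _ ih₁ ih₂ => exact ih₁.trans ih₂
  | comp_congr _ _ ih₁ ih₂ => simp only [arrow, ih₁, ih₂]
  | K1_congr B _ ih => simp only [arrow, obj, ih]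
  | K2_congr A _ ih => simp only [arrow, obj, ih]
  | L1_congr B _ ih => simp only [arrow, obj, ih]
  | L2_congr A _ ih => simp only [arrow, obj, ih]
  | pair_congr _ _ ih₁ ih₂ => simp only [arrow, obj, ih₁, ih₂]
  | copair_congr _ _ ih₁ ih₂ => simp only [arrow, obj, ih₁, ih₂]
  | cur_congr h => exact h.elim
  | k_eta h => exact h.elim
  | l_eta h => exact h.elim
  | dist_undist h => exact h.elim
  | undist_dist h => exact h.elim
  | dist_zero h => exact h.elim
  | beta h => exact h.elim
  | eta h => exact h.elim
  | pair_eta A B =>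
    simp only [arrow, obj, Category.comp_id, lift_fst_snd]
  | copair_eta A B =>
    simp only [arrow, obj, Category.id_comp, desc_inl_inr]
  | _ => simp [arrow, obj]

end BinaryProductsSums

/-! ### Points and copoints of formulae -/

section Points

variable {L : Type w}

/-- The interpretation of `×,+`-formulae in sets, with letters denoting a singleton. -/
def Formula.Point : Formula .timesPlus L → Type
  | .letter _ => Unit
  | .one h => h.elim
  | .zero h => h.elim
  | .prod A B => A.Point × B.Point
  | .sum A B => A.Point ⊕ B.Point
  | .exp h _ _ => h.elim

/-- The interpretation of `×,+`-formulae in the opposite of the category of sets, with letters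
denoting a singleton. -/
def Formula.Copoint : Formula .timesPlus L → Type
  | .letter _ => Unit
  | .one h => h.elim
  | .zero h => h.elim
  | .prod A B => A.Copoint ⊕ B.Copoint
  | .sum A B => A.Copoint × B.Copoint
  | .exp h _ _ => h.elim

/-- The absence of `O` is essential here, as is the absence of `I` for copoints. -/
theorem Formula.nonempty_point : ∀ A : Formula .timesPlus L, Nonempty A.Point
  | .letter _ => ⟨()⟩
  | .one h => h.elim
  | .zero h => h.elim
  | .prod A B => let ⟨a⟩ := nonempty_point A; let ⟨b⟩ := nonempty_point B; ⟨(a, b)⟩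
  | .sum A _ => let ⟨a⟩ := nonempty_point A; ⟨Sum.inl a⟩
  | .exp h _ _ => h.elim

theorem Formula.nonempty_copoint : ∀ A : Formula .timesPlus L, Nonempty A.Copoint
  | .letter _ => ⟨()⟩
  | .one h => h.elim
  | .zero h => h.elim
  | .sum A B => let ⟨a⟩ := nonempty_copoint A; let ⟨b⟩ := nonempty_copoint B; ⟨(a, b)⟩
  | .prod A _ => let ⟨a⟩ := nonempty_copoint A; ⟨Sum.inl a⟩
  | .exp h _ _ => h.elim

/-- The action of terms on points. -/
def Term.act : {A B : Formula .timesPlus L} → Term A B → A.Point → B.Point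
  | _, _, .id _ => fun e => e
  | _, _, .comp g f => fun e => g.act (f.act e)
  | _, _, .K1 _ f => fun e => f.act e.1
  | _, _, .K2 _ f => fun e => f.act e.2
  | _, _, .L1 _ f => fun e => Sum.inl (f.act e)
  | _, _, .L2 _ f => fun e => Sum.inr (f.act e)
  | _, _, .pair f g => fun e => (f.act e, g.act e)
  | _, _, .copair f g => fun e => Sum.elim f.act g.act e
  | _, _, .k h _ => h.elim
  | _, _, .l h _ => h.elim
  | _, _, .dist h _ _ _ => h.elim
  | _, _, .ev h _ _ => h.elim
  | _, _, .cur h _ => h.elim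

/-- The action of terms on copoints. -/
def Term.coact : {A B : Formula .timesPlus L} → Term A B → B.Copoint → A.Copoint
  | _, _, .id _ => fun e => e
  | _, _, .comp g f => fun e => f.coact (g.coact e)
  | _, _, .K1 _ f => fun e => Sum.inl (f.coact e)
  | _, _, .K2 _ f => fun e => Sum.inr (f.coact e)
  | _, _, .L1 _ f => fun e => f.coact e.1
  | _, _, .L2 _ f => fun e => f.coact e.2
  | _, _, .pair f g => fun e => Sum.elim f.coact g.coact e
  | _, _, .copair f g => fun e => (f.coact e, g.coact e)
  | _, _, .k h _ => h.elim
  | _, _, .l h _ => h.elim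
  | _, _, .dist h _ _ _ => h.elim
  | _, _, .ev h _ _ => h.elim
  | _, _, .cur h _ => h.elim

variable {A B C A₁ A₂ B₁ B₂ : Formula .timesPlus L}

/-- `L1 f` equals `L1 (id C)` composed with `f`, so this is an instance of `comp_copair`. The
permutations below come from the same rewriting. -/
theorem Eqn.copair_L1_L1 {c : Calculus} {A B C D : Formula c L} (f : Term A C) (g : Term B C) :
    Eqn (copair (L1 D f) (L1 D g)) (L1 D (copair f g)) := by
  have h : ∀ {E : Formula c L} (t : Term E C), Eqn (comp (L1 D (Term.id C)) t) (L1 D t) :=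
    fun t => (Eqn.L1_comp D _ t).trans (.L1_congr D (.id_comp t))
  exact ((Eqn.copair_congr (h f) (h g)).symm.trans (Eqn.comp_copair _ f g).symm).trans (h _)

theorem Eqn.copair_L2_L2 {c : Calculus} {A B C D : Formula c L} (f : Term A C) (g : Term B C) :
    Eqn (copair (L2 D f) (L2 D g)) (L2 D (copair f g)) := by
  have h : ∀ {E : Formula c L} (t : Term E C), Eqn (comp (L2 D (Term.id C)) t) (L2 D t) :=
    fun t => (Eqn.L2_comp D _ t).trans (.L2_congr D (.id_comp t))
  exact ((Eqn.copair_congr (h f) (h g)).symm.trans (Eqn.comp_copair _ f g).symm).trans (h _)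

theorem Eqn.pair_K1_K1 {c : Calculus} {A B C D : Formula c L} (f : Term C A) (g : Term C B) :
    Eqn (pair (K1 D f) (K1 D g)) (K1 D (pair f g)) := by
  have h : ∀ {E : Formula c L} (t : Term C E), Eqn (comp t (K1 D (Term.id C))) (K1 D t) :=
    fun t => (Eqn.comp_K1 D t _).trans (.K1_congr D (.comp_id t))
  exact ((Eqn.pair_congr (h f) (h g)).symm.trans (Eqn.pair_comp f g _).symm).trans (h _)

theorem Eqn.pair_K2_K2 {c : Calculus} {A B C D : Formula c L} (f : Term C A) (g : Term C B) :
    Eqn (pair (K2 D f) (K2 D g)) (K2 D (pair f g)) := by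
  have h : ∀ {E : Formula c L} (t : Term C E), Eqn (comp t (K2 D (Term.id C))) (K2 D t) :=
    fun t => (Eqn.comp_K2 D t _).trans (.K2_congr D (.comp_id t))
  exact ((Eqn.pair_congr (h f) (h g)).symm.trans (Eqn.pair_comp f g _).symm).trans (h _)

theorem Eqn.L1_K1 {c : Calculus} {A B C D : Formula c L} (f : Term A B) :
    Eqn (L1 D (K1 C f)) (K1 C (L1 D f)) :=
  ((Eqn.L1_comp D _ _).trans (.L1_congr D (.id_comp _))).symm.trans
    ((Eqn.comp_K1 C (L1 D (Term.id B)) f).trans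
      (.K1_congr C ((Eqn.L1_comp D _ _).trans (.L1_congr D (.id_comp _)))))

theorem Eqn.L1_K2 {c : Calculus} {A B C D : Formula c L} (f : Term A B) :
    Eqn (L1 D (K2 C f)) (K2 C (L1 D f)) :=
  ((Eqn.L1_comp D _ _).trans (.L1_congr D (.id_comp _))).symm.trans
    ((Eqn.comp_K2 C (L1 D (Term.id B)) f).trans
      (.K2_congr C ((Eqn.L1_comp D _ _).trans (.L1_congr D (.id_comp _)))))

theorem Eqn.L2_K1 {c : Calculus} {A B C D : Formula c L} (f : Term A B) :
    Eqn (L2 D (K1 C f)) (K1 C (L2 D f)) :=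
  ((Eqn.L2_comp D _ _).trans (.L2_congr D (.id_comp _))).symm.trans
    ((Eqn.comp_K1 C (L2 D (Term.id B)) f).trans
      (.K1_congr C ((Eqn.L2_comp D _ _).trans (.L2_congr D (.id_comp _)))))

theorem Eqn.L2_K2 {c : Calculus} {A B C D : Formula c L} (f : Term A B) :
    Eqn (L2 D (K2 C f)) (K2 C (L2 D f)) :=
  ((Eqn.L2_comp D _ _).trans (.L2_congr D (.id_comp _))).symm.trans
    ((Eqn.comp_K2 C (L2 D (Term.id B)) f).trans
      (.K2_congr C ((Eqn.L2_comp D _ _).trans (.L2_congr D (.id_comp _)))))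

/-! ### Cut-free terms that factor through an injection or a projection -/

namespace Term.CutFree

/-- Induction on the cut-free term: `K1`, `K2` and `copair` commute with `L1`, and a final `L2` is
refuted by any point of the source, which exists by `nonempty_point`. The other three lemmas are the
mirror images and duals. -/
theorem factors_L1 : ∀ {A : Formula .timesPlus L} {f : Term A (sum B₁ B₂)}, f.CutFree →
    (∀ e, Sum.isLeft (f.act e) = true) → ∃ g, Eqn f (Term.L1 B₂ g)
  | _, _, .K1 B hf, h => by
    obtain ⟨b⟩ := B.nonempty_point
    obtain ⟨g, hg⟩ := factors_L1 hf fun e => h (e, b)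
    exact ⟨_, (hg.K1_congr B).trans (.symm (.L1_K1 g))⟩
  | _, _, .K2 A hf, h => by
    obtain ⟨a⟩ := A.nonempty_point
    obtain ⟨g, hg⟩ := factors_L1 hf fun e => h (a, e)
    exact ⟨_, (hg.K2_congr A).trans (.symm (.L1_K2 g))⟩
  | _, _, .L1 _ _, _ => ⟨_, .refl _⟩
  | A, _, .L2 _ _, h => by
    obtain ⟨a⟩ := A.nonempty_point
    exact absurd (h a) Bool.false_ne_true
  | _, _, .copair hf hg, h => by
    obtain ⟨f', hf'⟩ := factors_L1 hf fun e => h (Sum.inl e)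
    obtain ⟨g', hg'⟩ := factors_L1 hg fun e => h (Sum.inr e)
    exact ⟨_, (hf'.copair_congr hg').trans (.copair_L1_L1 _ _)⟩
  | _, _, .l h _, _ => h.elim

theorem factors_L2 : ∀ {A : Formula .timesPlus L} {f : Term A (sum B₁ B₂)}, f.CutFree →
    (∀ e, Sum.isLeft (f.act e) = false) → ∃ g, Eqn f (Term.L2 B₁ g)
  | _, _, .K1 B hf, h => by
    obtain ⟨b⟩ := B.nonempty_point
    obtain ⟨g, hg⟩ := factors_L2 hf fun e => h (e, b)
    exact ⟨_, (hg.K1_congr B).trans (.symm (.L2_K1 g))⟩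
  | _, _, .K2 A hf, h => by
    obtain ⟨a⟩ := A.nonempty_point
    obtain ⟨g, hg⟩ := factors_L2 hf fun e => h (a, e)
    exact ⟨_, (hg.K2_congr A).trans (.symm (.L2_K2 g))⟩
  | _, _, .L2 _ _, _ => ⟨_, .refl _⟩
  | A, _, .L1 _ _, h => by
    obtain ⟨a⟩ := A.nonempty_point
    exact absurd (h a).symm Bool.false_ne_true
  | _, _, .copair hf hg, h => by
    obtain ⟨f', hf'⟩ := factors_L2 hf fun e => h (Sum.inl e)
    obtain ⟨g', hg'⟩ := factors_L2 hg fun e => h (Sum.inr e)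
    exact ⟨_, (hf'.copair_congr hg').trans (.copair_L2_L2 _ _)⟩
  | _, _, .l h _, _ => h.elim

theorem factors_K1 : ∀ {B : Formula .timesPlus L} {f : Term (prod A₁ A₂) B}, f.CutFree →
    (∀ e, Sum.isLeft (f.coact e) = true) → ∃ g, Eqn f (Term.K1 A₂ g)
  | _, _, .L1 B hf, h => by
    obtain ⟨b⟩ := B.nonempty_copoint
    obtain ⟨g, hg⟩ := factors_K1 hf fun e => h (e, b)
    exact ⟨_, (hg.L1_congr B).trans (.L1_K1 g)⟩
  | _, _, .L2 A hf, h => by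
    obtain ⟨a⟩ := A.nonempty_copoint
    obtain ⟨g, hg⟩ := factors_K1 hf fun e => h (a, e)
    exact ⟨_, (hg.L2_congr A).trans (.L2_K1 g)⟩
  | _, _, .K1 _ _, _ => ⟨_, .refl _⟩
  | B, _, .K2 _ _, h => by
    obtain ⟨b⟩ := B.nonempty_copoint
    exact absurd (h b) Bool.false_ne_true
  | _, _, .pair hf hg, h => by
    obtain ⟨f', hf'⟩ := factors_K1 hf fun e => h (Sum.inl e)
    obtain ⟨g', hg'⟩ := factors_K1 hg fun e => h (Sum.inr e)
    exact ⟨_, (hf'.pair_congr hg').trans (.pair_K1_K1 _ _)⟩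
  | _, _, .k h _, _ => h.elim

theorem factors_K2 : ∀ {B : Formula .timesPlus L} {f : Term (prod A₁ A₂) B}, f.CutFree →
    (∀ e, Sum.isLeft (f.coact e) = false) → ∃ g, Eqn f (Term.K2 A₁ g)
  | _, _, .L1 B hf, h => by
    obtain ⟨b⟩ := B.nonempty_copoint
    obtain ⟨g, hg⟩ := factors_K2 hf fun e => h (e, b)
    exact ⟨_, (hg.L1_congr B).trans (.L1_K2 g)⟩
  | _, _, .L2 A hf, h => by
    obtain ⟨a⟩ := A.nonempty_copoint
    obtain ⟨g, hg⟩ := factors_K2 hf fun e => h (a, e)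
    exact ⟨_, (hg.L2_congr A).trans (.L2_K2 g)⟩
  | _, _, .K2 _ _, _ => ⟨_, .refl _⟩
  | B, _, .K1 _ _, h => by
    obtain ⟨b⟩ := B.nonempty_copoint
    exact absurd (h b).symm Bool.false_ne_true
  | _, _, .pair hf hg, h => by
    obtain ⟨f', hf'⟩ := factors_K2 hf fun e => h (Sum.inl e)
    obtain ⟨g', hg'⟩ := factors_K2 hg fun e => h (Sum.inr e)
    exact ⟨_, (hf'.pair_congr hg').trans (.pair_K2_K2 _ _)⟩
  | _, _, .k h _, _ => h.elim

end Term.CutFree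

/-! ### Points and copoints realised as arrows -/

namespace BinaryProductsSums

variable {𝓑 : Type u} [Category.{v} 𝓑] (S : BinaryProductsSums 𝓑) (X : 𝓑)

/-- The arrow out of `X` denoted by a point when every letter denotes `X`. -/
def point : (A : Formula .timesPlus L) → A.Point → (X ⟶ S.obj (fun _ => X) A)
  | .letter _, _ => 𝟙 X
  | .one h, _ => h.elim
  | .zero h, _ => h.elim
  | .prod A B, e => S.lift (point A e.1) (point B e.2)
  | .sum A B, e =>
    Sum.elim (fun a => point A a ≫ S.inl _ _) (fun b => point B b ≫ S.inr _ _) e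
  | .exp h _ _, _ => h.elim

/-- The arrow into `X` denoted by a copoint when every letter denotes `X`. -/
def copoint : (A : Formula .timesPlus L) → A.Copoint → (S.obj (fun _ => X) A ⟶ X)
  | .letter _, _ => 𝟙 X
  | .one h, _ => h.elim
  | .zero h, _ => h.elim
  | .sum A B, r => S.desc (copoint A r.1) (copoint B r.2)
  | .prod A B, r =>
    Sum.elim (fun a => S.fst _ _ ≫ copoint A a) (fun b => S.snd _ _ ≫ copoint B b) r
  | .exp h _ _, _ => h.elim

-- Every letter denotes the same `X`, so following a point into a formula and a copoint out of it
-- only ever meets identities of `X`.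
@[simp]
theorem point_copoint :
    ∀ (A : Formula .timesPlus L) (e r), S.point X A e ≫ S.copoint X A r = 𝟙 X
  | .letter _, _, _ => Category.comp_id _
  | .one h, _, _ => h.elim
  | .zero h, _, _ => h.elim
  | .prod A B, (e₁, e₂), .inl r => by simp [point, copoint, obj, point_copoint A]
  | .prod A B, (e₁, e₂), .inr r => by simp [point, copoint, obj, point_copoint B]
  | .sum A B, .inl e, (r₁, r₂) => by simp [point, copoint, obj, point_copoint A]
  | .sum A B, .inr e, (r₁, r₂) => by simp [point, copoint, obj, point_copoint B]
  | .exp h _ _, _, _ => h.elim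

theorem point_arrow {A B : Formula .timesPlus L} (f : Term A B) (e : A.Point) :
    S.point X A e ≫ S.arrow (fun _ => X) f = S.point X B (f.act e) := by
  induction f with
  | id A => exact Category.comp_id _
  | comp g f ihg ihf => simp only [arrow, act, ← ihg, ← ihf, Category.assoc]
  | K1 B f ih => simp only [arrow, obj, act, ← ih, point, lift_fst_assoc]
  | K2 B f ih => simp only [arrow, obj, act, ← ih, point, lift_snd_assoc]
  | L1 B f ih => simp only [arrow, obj, act, point, ← Category.assoc, ih, Sum.elim_inl]
  | L2 B f ih => simp only [arrow, obj, act, point, ← Category.assoc, ih, Sum.elim_inr]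
  | pair f g ihf ihg => simp only [arrow, obj, act, point, comp_lift, ihf, ihg]
  | copair f g ihf ihg =>
    rcases e with e | e
    · simp only [arrow, obj, act, point, Sum.elim_inl, Category.assoc, inl_desc, ihf]
    · simp only [arrow, obj, act, point, Sum.elim_inr, Category.assoc, inr_desc, ihg]
  | k h => exact h.elim
  | l h => exact h.elim
  | dist h => exact h.elim
  | ev h => exact h.elim
  | cur h => exact h.elim

theorem arrow_copoint {A B : Formula .timesPlus L} (f : Term A B) (r : B.Copoint) :
    S.arrow (fun _ => X) f ≫ S.copoint X B r = S.copoint X A (f.coact r) := by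
  induction f with
  | id A => exact Category.id_comp _
  | comp g f ihg ihf => simp only [arrow, coact, ← ihg, ← ihf, Category.assoc]
  | K1 B f ih => simp only [arrow, obj, coact, copoint, Category.assoc, ih, Sum.elim_inl]
  | K2 B f ih => simp only [arrow, obj, coact, copoint, Category.assoc, ih, Sum.elim_inr]
  | L1 B f ih => simp only [arrow, obj, coact, ← ih, copoint, Category.assoc, inl_desc]
  | L2 B f ih => simp only [arrow, obj, coact, ← ih, copoint, Category.assoc, inr_desc]
  | pair f g ihf ihg =>
    rcases r with r | r
    · simp only [arrow, obj, coact, copoint, Sum.elim_inl, lift_fst_assoc, ihf]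
    · simp only [arrow, obj, coact, copoint, Sum.elim_inr, lift_snd_assoc, ihg]
  | copair f g ihf ihg => simp only [arrow, obj, coact, copoint, desc_comp, ihf, ihg]
  | k h => exact h.elim
  | l h => exact h.elim
  | dist h => exact h.elim
  | ev h => exact h.elim
  | cur h => exact h.elim

variable {S X}

/-- The summand hit by a point can be read off from the arrow, by testing it against an arrow to `X
+ X` whose injections differ. -/
theorem isLeft_act_eq (hX : S.inl X X ≠ S.inr X X) {f g : Term A (.sum B₁ B₂)}
    (h : S.arrow (fun _ => X) f = S.arrow (fun _ => X) g) (e : A.Point) :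
    Sum.isLeft (f.act e) = Sum.isLeft (g.act e) := by
  have key : S.point X _ (f.act e) = S.point X _ (g.act e) := by
    rw [← point_arrow, ← point_arrow, h]
  obtain ⟨r₁⟩ := B₁.nonempty_copoint
  obtain ⟨r₂⟩ := B₂.nonempty_copoint
  -- The test arrow `B₁ + B₂ → X + X` collapses each summand to `X` by a copoint; a point in the
  -- left summand becomes `inl`, one in the right summand `inr`.
  have key' := congrArg
    (· ≫ S.desc (S.copoint X B₁ r₁ ≫ S.inl X X) (S.copoint X B₂ r₂ ≫ S.inr X X)) key
  have hl : ∀ x, S.point X (.sum B₁ B₂) (Sum.inl x) ≫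
      S.desc (S.copoint X B₁ r₁ ≫ S.inl X X) (S.copoint X B₂ r₂ ≫ S.inr X X) = S.inl X X := by
    intro x
    simp only [point, obj, Sum.elim_inl, Category.assoc, inl_desc]
    rw [← Category.assoc, point_copoint, Category.id_comp]
  have hr : ∀ x, S.point X (.sum B₁ B₂) (Sum.inr x) ≫
      S.desc (S.copoint X B₁ r₁ ≫ S.inl X X) (S.copoint X B₂ r₂ ≫ S.inr X X) = S.inr X X := by
    intro x
    simp only [point, obj, Sum.elim_inr, Category.assoc, inr_desc]
    rw [← Category.assoc, point_copoint, Category.id_comp]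
  revert key'
  rcases f.act e with x | x <;> rcases g.act e with y | y <;> intro key'
  · rfl
  · exact absurd ((hl x).symm.trans (key'.trans (hr y))) hX
  · exact absurd ((hl y).symm.trans (key'.symm.trans (hr x))) hX
  · rfl

theorem isLeft_coact_eq (hX : S.fst X X ≠ S.snd X X) {f g : Term (.prod A₁ A₂) B}
    (h : S.arrow (fun _ => X) f = S.arrow (fun _ => X) g) (r : B.Copoint) :
    Sum.isLeft (f.coact r) = Sum.isLeft (g.coact r) := by
  have key : S.copoint X _ (f.coact r) = S.copoint X _ (g.coact r) := by
    rw [← arrow_copoint, ← arrow_copoint, h]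
  obtain ⟨e₁⟩ := A₁.nonempty_point
  obtain ⟨e₂⟩ := A₂.nonempty_point
  have key' := congrArg
    (S.lift (S.fst X X ≫ S.point X A₁ e₁) (S.snd X X ≫ S.point X A₂ e₂) ≫ ·) key
  have hl : ∀ x, S.lift (S.fst X X ≫ S.point X A₁ e₁) (S.snd X X ≫ S.point X A₂ e₂) ≫
      S.copoint X (.prod A₁ A₂) (Sum.inl x) = S.fst X X := by
    intro x
    simp only [copoint, obj, Sum.elim_inl, lift_fst_assoc]
    rw [Category.assoc, point_copoint, Category.comp_id]
  have hr : ∀ x, S.lift (S.fst X X ≫ S.point X A₁ e₁) (S.snd X X ≫ S.point X A₂ e₂) ≫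
      S.copoint X (.prod A₁ A₂) (Sum.inr x) = S.snd X X := by
    intro x
    simp only [copoint, obj, Sum.elim_inr, lift_snd_assoc]
    rw [Category.assoc, point_copoint, Category.comp_id]
  revert key'
  rcases f.coact r with x | x <;> rcases g.coact r with y | y <;> intro key'
  · rfl
  · exact absurd ((hl x).symm.trans (key'.trans (hr y))) hX
  · exact absurd ((hl y).symm.trans (key'.symm.trans (hr x))) hX
  · rfl

/-- A copoint of `A` followed by a point of `B` gives an arrow between the denotations of any two
formulae; paired with the identity it splits the projection. This is what makes `K1` cancellable. -/
theorem exists_section_fst (A B : Formula .timesPlus L) :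
    ∃ s, s ≫ S.fst (S.obj (fun _ => X) A) (S.obj (fun _ => X) B) = 𝟙 _ := by
  obtain ⟨r⟩ := A.nonempty_copoint
  obtain ⟨e⟩ := B.nonempty_point
  exact ⟨S.lift (𝟙 _) (S.copoint X A r ≫ S.point X B e), S.lift_fst _ _⟩

theorem exists_section_snd (A B : Formula .timesPlus L) :
    ∃ s, s ≫ S.snd (S.obj (fun _ => X) A) (S.obj (fun _ => X) B) = 𝟙 _ := by
  obtain ⟨r⟩ := B.nonempty_copoint
  obtain ⟨e⟩ := A.nonempty_point
  exact ⟨S.lift (S.copoint X B r ≫ S.point X A e) (𝟙 _), S.lift_snd _ _⟩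

theorem exists_retraction_inl (A B : Formula .timesPlus L) :
    ∃ s, S.inl (S.obj (fun _ => X) A) (S.obj (fun _ => X) B) ≫ s = 𝟙 _ := by
  obtain ⟨r⟩ := B.nonempty_copoint
  obtain ⟨e⟩ := A.nonempty_point
  exact ⟨S.desc (𝟙 _) (S.copoint X B r ≫ S.point X A e), S.inl_desc _ _⟩

theorem exists_retraction_inr (A B : Formula .timesPlus L) :
    ∃ s, S.inr (S.obj (fun _ => X) A) (S.obj (fun _ => X) B) ≫ s = 𝟙 _ := by
  obtain ⟨r⟩ := A.nonempty_copoint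
  obtain ⟨e⟩ := B.nonempty_point
  exact ⟨S.desc (S.copoint X A r ≫ S.point X B e) (𝟙 _), S.inr_desc _ _⟩

variable (S)

/-- The equation `f = g` holds in `𝓑` when all letters denote the same object. -/
def Agree (f g : Term A B) : Prop :=
  ∀ X : 𝓑, S.arrow (fun _ => X) f = S.arrow (fun _ => X) g

variable {S}

namespace Agree

theorem symm {f g : Term A B} (h : S.Agree f g) : S.Agree g f := fun X => (h X).symm

theorem congr {f g f' g' : Term A B} (h : S.Agree f g) (ef : Eqn f f') (eg : Eqn g g') :
    S.Agree f' g' := fun X => by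
  rw [← S.arrow_eq_of_eqn _ ef, ← S.arrow_eq_of_eqn _ eg, h X]

theorem comp_left {f g : Term A B} (h : S.Agree f g) (t : Term B C) :
    S.Agree (comp t f) (comp t g) := fun X => by
  simp only [arrow, h X]

theorem comp_right {f g : Term B C} (h : S.Agree f g) (t : Term A B) :
    S.Agree (comp f t) (comp g t) := fun X => by
  simp only [arrow, h X]

theorem of_K1 {f g : Term A₁ B} (h : S.Agree (K1 A₂ f) (K1 A₂ g)) : S.Agree f g := fun X => by
  obtain ⟨s, hs⟩ := exists_section_fst (S := S) (X := X) A₁ A₂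
  simpa [arrow, obj, ← Category.assoc, hs] using congrArg (s ≫ ·) (h X)

theorem of_K2 {f g : Term A₂ B} (h : S.Agree (K2 A₁ f) (K2 A₁ g)) : S.Agree f g := fun X => by
  obtain ⟨s, hs⟩ := exists_section_snd (S := S) (X := X) A₁ A₂
  simpa [arrow, obj, ← Category.assoc, hs] using congrArg (s ≫ ·) (h X)

theorem of_L1 {f g : Term A B₁} (h : S.Agree (L1 B₂ f) (L1 B₂ g)) : S.Agree f g := fun X => by
  obtain ⟨s, hs⟩ := exists_retraction_inl (S := S) (X := X) B₁ B₂
  simpa [arrow, obj, hs] using congrArg (· ≫ s) (h X)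

theorem of_L2 {f g : Term A B₂} (h : S.Agree (L2 B₁ f) (L2 B₁ g)) : S.Agree f g := fun X => by
  obtain ⟨s, hs⟩ := exists_retraction_inr (S := S) (X := X) B₁ B₂
  simpa [arrow, obj, hs] using congrArg (· ≫ s) (h X)

end Agree

end BinaryProductsSums

end Points


/-! ### Maximality -/

section Coherence

variable {L : Type w} {A B A₁ A₂ B₁ B₂ : Formula .timesPlus L}

theorem Term.cutFree_prod_sum_cases {f : Term (.prod A₁ A₂) (.sum B₁ B₂)} (hf : f.CutFree) :
    (∃ g, g.CutFree ∧ f = .K1 A₂ g) ∨ (∃ g, g.CutFree ∧ f = .K2 A₁ g) ∨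
      (∃ g, g.CutFree ∧ f = .L1 B₂ g) ∨ (∃ g, g.CutFree ∧ f = .L2 B₁ g) := by
  cases hf with
  | K1 _ h => exact .inl ⟨_, h, rfl⟩
  | K2 _ h => exact .inr (.inl ⟨_, h, rfl⟩)
  | L1 _ h => exact .inr (.inr (.inl ⟨_, h, rfl⟩))
  | L2 _ h => exact .inr (.inr (.inr ⟨_, h, rfl⟩))

theorem Term.cutFree_prod_letter_cases {p : L} {f : Term (.prod A₁ A₂) (.letter p)}
    (hf : f.CutFree) :
    (∃ g, g.CutFree ∧ f = .K1 A₂ g) ∨ (∃ g, g.CutFree ∧ f = .K2 A₁ g) := by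
  cases hf with
  | K1 _ h => exact .inl ⟨_, h, rfl⟩
  | K2 _ h => exact .inr ⟨_, h, rfl⟩

theorem Term.cutFree_letter_sum_cases {p : L} {f : Term (.letter p) (.sum B₁ B₂)}
    (hf : f.CutFree) :
    (∃ g, g.CutFree ∧ f = .L1 B₂ g) ∨ (∃ g, g.CutFree ∧ f = .L2 B₁ g) := by
  cases hf with
  | L1 _ h => exact .inl ⟨_, h, rfl⟩
  | L2 _ h => exact .inr ⟨_, h, rfl⟩

theorem Term.CutFree.eq_of_letter {p q : L} {f g : Term (c := .timesPlus) (.letter p) (.letter q)}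
    (hf : f.CutFree) (hg : g.CutFree) : f = g := by
  cases hf
  cases hg
  rfl

/-- By `pair_eta` and `pair_comp` every term into a product is the pair of its projections. -/
theorem Eqn.of_comp_projections {c : Calculus} {A B C : Formula c L} {f g : Term C (.prod A B)}
    (h₁ : Eqn (comp (.K1 B (.id A)) f) (comp (.K1 B (.id A)) g))
    (h₂ : Eqn (comp (.K2 A (.id B)) f) (comp (.K2 A (.id B)) g)) : Eqn f g := by
  have h : ∀ t : Term C (.prod A B),
      Eqn t (pair (comp (.K1 B (.id A)) t) (comp (.K2 A (.id B)) t)) := fun t =>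
    (Eqn.id_comp t).symm.trans (((Eqn.pair_eta A B).symm.comp_congr (.refl t)).trans
      (.pair_comp _ _ _))
  exact (h f).trans ((h₁.pair_congr h₂).trans (h g).symm)

theorem Eqn.of_comp_injections {c : Calculus} {A B C : Formula c L} {f g : Term (.sum A B) C}
    (h₁ : Eqn (comp f (.L1 B (.id A))) (comp g (.L1 B (.id A))))
    (h₂ : Eqn (comp f (.L2 A (.id B))) (comp g (.L2 A (.id B)))) : Eqn f g := by
  have h : ∀ t : Term (.sum A B) C,
      Eqn t (copair (comp t (.L1 B (.id A))) (comp t (.L2 A (.id B)))) := fun t =>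
    (Eqn.comp_id t).symm.trans ((Eqn.comp_congr (.refl t) (Eqn.copair_eta A B).symm).trans
      (.comp_copair _ _ _))
  exact (h f).trans ((h₁.copair_congr h₂).trans (h g).symm)

namespace BinaryProductsSums

variable {𝓑 : Type u} [Category.{v} 𝓑] {S : BinaryProductsSums 𝓑} {X Y : 𝓑}

/-- `K1 f` sends every copoint to the left and `K2 g` to the right, and there is at least one
copoint. -/
theorem not_agree_K1_K2 (hY : S.fst Y Y ≠ S.snd Y Y) {f : Term A₁ B} {g : Term A₂ B} :
    ¬ S.Agree (.K1 A₂ f) (.K2 A₁ g) := fun h => by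
  obtain ⟨r⟩ := B.nonempty_copoint
  exact Bool.false_ne_true (isLeft_coact_eq hY (h Y) r).symm

theorem not_agree_L1_L2 (hX : S.inl X X ≠ S.inr X X) {f : Term A B₁} {g : Term A B₂} :
    ¬ S.Agree (.L1 B₂ f) (.L2 B₁ g) := fun h => by
  obtain ⟨e⟩ := A.nonempty_point
  exact Bool.false_ne_true (isLeft_act_eq hX (h X) e).symm

/-- The critical case. Agreement with `L1 g` puts all points under `f` on the left, and agreement
with `K1 f` does the same for the copoints under `g`. Both sides thus have the form `L1 (K1 _)`, and
cancelling leaves terms `A₁ → B₁`. -/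
theorem eqn_K1_L1 (hX : S.inl X X ≠ S.inr X X) (hY : S.fst Y Y ≠ S.snd Y Y)
    (ih : ∀ f g : Term A₁ B₁, S.Agree f g → Eqn f g) {f : Term A₁ (.sum B₁ B₂)}
    {g : Term (.prod A₁ A₂) B₁} (hf : f.CutFree) (hg : g.CutFree)
    (h : S.Agree (.K1 A₂ f) (.L1 B₂ g)) : Eqn (.K1 A₂ f) (.L1 B₂ g) := by
  obtain ⟨e⟩ := A₂.nonempty_point
  obtain ⟨r⟩ := B₂.nonempty_copoint
  -- The action of `K1 A₂ f` ignores the second component, so any fixed point `e` of `A₂` extends a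
  -- point of `A₁`.
  obtain ⟨f', ef⟩ := hf.factors_L1 fun e' => isLeft_act_eq hX (h X) (e', e)
  obtain ⟨g', eg⟩ := hg.factors_K1 fun r' => (isLeft_coact_eq hY (h Y) (r', r)).symm
  have ef' := (ef.K1_congr A₂).trans (Eqn.L1_K1 f').symm
  have eg' := eg.L1_congr B₂
  exact ef'.trans ((((ih _ _ (h.congr ef' eg').of_L1.of_K1).K1_congr _).L1_congr _).trans
    eg'.symm)

theorem eqn_K1_L2 (hX : S.inl X X ≠ S.inr X X) (hY : S.fst Y Y ≠ S.snd Y Y)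
    (ih : ∀ f g : Term A₁ B₂, S.Agree f g → Eqn f g) {f : Term A₁ (.sum B₁ B₂)}
    {g : Term (.prod A₁ A₂) B₂} (hf : f.CutFree) (hg : g.CutFree)
    (h : S.Agree (.K1 A₂ f) (.L2 B₁ g)) : Eqn (.K1 A₂ f) (.L2 B₁ g) := by
  obtain ⟨e⟩ := A₂.nonempty_point
  obtain ⟨r⟩ := B₁.nonempty_copoint
  obtain ⟨f', ef⟩ := hf.factors_L2 fun e' => isLeft_act_eq hX (h X) (e', e)
  obtain ⟨g', eg⟩ := hg.factors_K1 fun r' => (isLeft_coact_eq hY (h Y) (r, r')).symm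
  have ef' := (ef.K1_congr A₂).trans (Eqn.L2_K1 f').symm
  have eg' := eg.L2_congr B₁
  exact ef'.trans ((((ih _ _ (h.congr ef' eg').of_L2.of_K1).K1_congr _).L2_congr _).trans
    eg'.symm)

theorem eqn_K2_L1 (hX : S.inl X X ≠ S.inr X X) (hY : S.fst Y Y ≠ S.snd Y Y)
    (ih : ∀ f g : Term A₂ B₁, S.Agree f g → Eqn f g) {f : Term A₂ (.sum B₁ B₂)}
    {g : Term (.prod A₁ A₂) B₁} (hf : f.CutFree) (hg : g.CutFree)
    (h : S.Agree (.K2 A₁ f) (.L1 B₂ g)) : Eqn (.K2 A₁ f) (.L1 B₂ g) := by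
  obtain ⟨e⟩ := A₁.nonempty_point
  obtain ⟨r⟩ := B₂.nonempty_copoint
  obtain ⟨f', ef⟩ := hf.factors_L1 fun e' => isLeft_act_eq hX (h X) (e, e')
  obtain ⟨g', eg⟩ := hg.factors_K2 fun r' => (isLeft_coact_eq hY (h Y) (r', r)).symm
  have ef' := (ef.K2_congr A₁).trans (Eqn.L1_K2 f').symm
  have eg' := eg.L1_congr B₂
  exact ef'.trans ((((ih _ _ (h.congr ef' eg').of_L1.of_K2).K2_congr _).L1_congr _).trans
    eg'.symm)

theorem eqn_K2_L2 (hX : S.inl X X ≠ S.inr X X) (hY : S.fst Y Y ≠ S.snd Y Y)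
    (ih : ∀ f g : Term A₂ B₂, S.Agree f g → Eqn f g) {f : Term A₂ (.sum B₁ B₂)}
    {g : Term (.prod A₁ A₂) B₂} (hf : f.CutFree) (hg : g.CutFree)
    (h : S.Agree (.K2 A₁ f) (.L2 B₁ g)) : Eqn (.K2 A₁ f) (.L2 B₁ g) := by
  obtain ⟨e⟩ := A₁.nonempty_point
  obtain ⟨r⟩ := B₁.nonempty_copoint
  obtain ⟨f', ef⟩ := hf.factors_L2 fun e' => isLeft_act_eq hX (h X) (e, e')
  obtain ⟨g', eg⟩ := hg.factors_K2 fun r' => (isLeft_coact_eq hY (h Y) (r, r')).symm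
  have ef' := (ef.K2_congr A₁).trans (Eqn.L2_K2 f').symm
  have eg' := eg.L2_congr B₁
  exact ef'.trans ((((ih _ _ (h.congr ef' eg').of_L2.of_K2).K2_congr _).L2_congr _).trans
    eg'.symm)

theorem eqn_of_agree_of_cutFree
    (h : ∀ f g : Term A B, f.CutFree → g.CutFree → S.Agree f g → Eqn f g) (f g : Term A B)
    (hfg : S.Agree f g) : Eqn f g := by
  -- For `timesPlus` both side conditions are `¬ False`, proved by the identity function.
  obtain ⟨f', hf, ef⟩ := f.reducible _root_.id _root_.id
  obtain ⟨g', hg, eg⟩ := g.reducible _root_.id _root_.id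
  exact ef.trans ((h f' g' hf hg (hfg.congr ef eg)).trans eg.symm)

theorem eqn_prod_letter (hY : S.fst Y Y ≠ S.snd Y Y) {p : L}
    (ih₁ : ∀ f g : Term A₁ (.letter p), S.Agree f g → Eqn f g)
    (ih₂ : ∀ f g : Term A₂ (.letter p), S.Agree f g → Eqn f g) :
    ∀ f g : Term (.prod A₁ A₂) (.letter p), S.Agree f g → Eqn f g := by
  refine eqn_of_agree_of_cutFree fun f g hf hg h => ?_
  rcases cutFree_prod_letter_cases hf with ⟨f, -, rfl⟩ | ⟨f, -, rfl⟩ <;>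
    rcases cutFree_prod_letter_cases hg with ⟨g, -, rfl⟩ | ⟨g, -, rfl⟩
  · exact (ih₁ _ _ h.of_K1).K1_congr _
  · exact absurd h (not_agree_K1_K2 hY)
  · exact absurd h.symm (not_agree_K1_K2 hY)
  · exact (ih₂ _ _ h.of_K2).K2_congr _

theorem eqn_letter_sum (hX : S.inl X X ≠ S.inr X X) {p : L}
    (ih₁ : ∀ f g : Term (.letter p) B₁, S.Agree f g → Eqn f g)
    (ih₂ : ∀ f g : Term (.letter p) B₂, S.Agree f g → Eqn f g) :
    ∀ f g : Term (.letter p) (.sum B₁ B₂), S.Agree f g → Eqn f g := by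
  refine eqn_of_agree_of_cutFree fun f g hf hg h => ?_
  rcases cutFree_letter_sum_cases hf with ⟨f, -, rfl⟩ | ⟨f, -, rfl⟩ <;>
    rcases cutFree_letter_sum_cases hg with ⟨g, -, rfl⟩ | ⟨g, -, rfl⟩
  · exact (ih₁ _ _ h.of_L1).L1_congr _
  · exact absurd h (not_agree_L1_L2 hX)
  · exact absurd h.symm (not_agree_L1_L2 hX)
  · exact (ih₂ _ _ h.of_L2).L2_congr _

/-- Sixteen pairs of last operations: equal ones cancel, `K1` against `K2` and `L1` against `L2`
cannot agree, and the eight mixed pairs are critical cases, up to symmetry. -/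
theorem eqn_prod_sum (hX : S.inl X X ≠ S.inr X X) (hY : S.fst Y Y ≠ S.snd Y Y)
    (ihA₁ : ∀ B, ∀ f g : Term A₁ B, S.Agree f g → Eqn f g)
    (ihA₂ : ∀ B, ∀ f g : Term A₂ B, S.Agree f g → Eqn f g)
    (ihB₁ : ∀ f g : Term (.prod A₁ A₂) B₁, S.Agree f g → Eqn f g)
    (ihB₂ : ∀ f g : Term (.prod A₁ A₂) B₂, S.Agree f g → Eqn f g) :
    ∀ f g : Term (.prod A₁ A₂) (.sum B₁ B₂), S.Agree f g → Eqn f g := by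
  refine eqn_of_agree_of_cutFree fun f g hf hg h => ?_
  rcases cutFree_prod_sum_cases hf with
    ⟨f, hf', rfl⟩ | ⟨f, hf', rfl⟩ | ⟨f, hf', rfl⟩ | ⟨f, hf', rfl⟩ <;>
  rcases cutFree_prod_sum_cases hg with
    ⟨g, hg', rfl⟩ | ⟨g, hg', rfl⟩ | ⟨g, hg', rfl⟩ | ⟨g, hg', rfl⟩
  · exact (ihA₁ _ _ _ h.of_K1).K1_congr _
  · exact absurd h (not_agree_K1_K2 hY)
  · exact eqn_K1_L1 hX hY (ihA₁ _) hf' hg' h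
  · exact eqn_K1_L2 hX hY (ihA₁ _) hf' hg' h
  · exact absurd h.symm (not_agree_K1_K2 hY)
  · exact (ihA₂ _ _ _ h.of_K2).K2_congr _
  · exact eqn_K2_L1 hX hY (ihA₂ _) hf' hg' h
  · exact eqn_K2_L2 hX hY (ihA₂ _) hf' hg' h
  · exact (eqn_K1_L1 hX hY (ihA₁ _) hg' hf' h.symm).symm
  · exact (eqn_K2_L1 hX hY (ihA₂ _) hg' hf' h.symm).symm
  · exact (ihB₁ _ _ h.of_L1).L1_congr _
  · exact absurd h (not_agree_L1_L2 hX)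
  · exact (eqn_K1_L2 hX hY (ihA₁ _) hg' hf' h.symm).symm
  · exact (eqn_K2_L2 hX hY (ihA₂ _) hg' hf' h.symm).symm
  · exact absurd h.symm (not_agree_L1_L2 hX)
  · exact (ihB₂ _ _ h.of_L2).L2_congr _

theorem eqn_of_agree (hX : S.inl X X ≠ S.inr X X) (hY : S.fst Y Y ≠ S.snd Y Y)
    (A B : Formula .timesPlus L) : ∀ f g : Term A B, S.Agree f g → Eqn f g := by
  induction A generalizing B with
  | one h => exact h.elim
  | zero h => exact h.elim
  | exp h => exact h.elim
  | sum A₁ A₂ ih₁ ih₂ =>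
    exact fun f g h =>
      .of_comp_injections (ih₁ _ _ _ (h.comp_right _)) (ih₂ _ _ _ (h.comp_right _))
  | letter p =>
    induction B with
    | one h => exact h.elim
    | zero h => exact h.elim
    | exp h => exact h.elim
    | letter q =>
      refine eqn_of_agree_of_cutFree fun f g hf hg _ => ?_
      rw [hf.eq_of_letter hg]
      exact .refl g
    | prod B₁ B₂ ih₁ ih₂ =>
      exact fun f g h =>
        .of_comp_projections (ih₁ _ _ (h.comp_left _)) (ih₂ _ _ (h.comp_left _))
    | sum B₁ B₂ ih₁ ih₂ => exact eqn_letter_sum hX ih₁ ih₂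
  | prod A₁ A₂ ihA₁ ihA₂ =>
    induction B with
    | one h => exact h.elim
    | zero h => exact h.elim
    | exp h => exact h.elim
    | letter q => exact eqn_prod_letter hY (ihA₁ _) (ihA₂ _)
    | prod B₁ B₂ ih₁ ih₂ =>
      exact fun f g h =>
        .of_comp_projections (ih₁ _ _ (h.comp_left _)) (ih₂ _ _ (h.comp_left _))
    | sum B₁ B₂ ih₁ ih₂ => exact eqn_prod_sum hX hY ihA₁ ihA₂ ih₁ ih₂

/-- If the injections coincided, every pair `f`, `g` would be equal, both being an injection
followed by `desc f g`. The source of a distinct pair serves for sums, the target for products. -/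
theorem inl_ne_inr {f g : X ⟶ Y} (h : f ≠ g) : S.inl X X ≠ S.inr X X := fun e => h <| by
  rw [← S.inl_desc f g, e, S.inr_desc]

theorem fst_ne_snd {f g : X ⟶ Y} (h : f ≠ g) : S.fst Y Y ≠ S.snd Y Y := fun e => h <| by
  rw [← S.lift_fst f g, e, S.lift_snd]

variable (S)

/-- Maximality: a category with binary products and sums that is not a preorder satisfies only
the equations provable in the free one. -/
theorem holds_iff_eqn (h𝓑 : ¬ Quiver.IsThin 𝓑) (f g : Term A B) : S.Holds f g ↔ Eqn f g := by
  refine ⟨fun h => ?_, fun e a => S.arrow_eq_of_eqn a e⟩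
  obtain ⟨X, Y, hXY⟩ : ∃ X Y : 𝓑, ¬ Subsingleton (X ⟶ Y) := by
    simpa [Quiver.IsThin] using h𝓑
  rw [not_subsingleton_iff_nontrivial] at hXY
  obtain ⟨s, t, hst⟩ := hXY
  exact eqn_of_agree (inl_ne_inr hst) (fst_ne_snd hst) A B f g fun X => h fun _ => X

end BinaryProductsSums

end Coherence

/-! ### The model in sets: conservativity and faithfulness -/

section Sets

variable {L : Type w} {c : Calculus}

/-- The set denoted by a formula when the letters denote the sets `a p`. -/
def Formula.toType (a : L → Type) : Formula c L → Type
  | .letter p => a p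
  | .one _ => Unit
  | .zero _ => Empty
  | .prod A B => A.toType a × B.toType a
  | .sum A B => A.toType a ⊕ B.toType a
  | .exp _ A B => A.toType a → B.toType a

/-- The function denoted by a term. -/
def Term.toFun (a : L → Type) :
    {A B : Formula c L} → Term A B → A.toType a → B.toType a
  | _, _, .id _ => fun x => x
  | _, _, .comp g f => fun x => g.toFun a (f.toFun a x)
  | _, _, .K1 _ f => fun x => f.toFun a x.1
  | _, _, .K2 _ f => fun x => f.toFun a x.2
  | _, _, .L1 _ f => fun x => Sum.inl (f.toFun a x)
  | _, _, .L2 _ f => fun x => Sum.inr (f.toFun a x)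
  | _, _, .pair f g => fun x => (f.toFun a x, g.toFun a x)
  | _, _, .copair f g => fun x => Sum.elim (f.toFun a) (g.toFun a) x
  | _, _, .k _ _ => fun _ => ()
  | _, _, .l _ _ => fun x => Empty.elim x
  | _, _, .dist _ _ _ _ => fun x =>
    Sum.elim (fun y => Sum.inl (x.1, y)) (fun z => Sum.inr (x.1, z)) x.2
  | _, _, .ev _ _ _ => fun x => x.2 x.1
  | _, _, .cur _ f => fun x y => f.toFun a (y, x)

theorem Eqn.toFun_eq (a : L → Type) {A B : Formula c L} {f g : Term A B} (e : Eqn f g) :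
    f.toFun a = g.toFun a := by
  induction e with
  | symm _ ih => exact ih.symm
  | trans _ _ ih₁ ih₂ => exact ih₁.trans ih₂
  | comp_congr _ _ ih₁ ih₂ => simp only [toFun, ih₁, ih₂]
  | K1_congr B _ ih => simp only [toFun, Formula.toType, ih]
  | K2_congr A _ ih => simp only [toFun, Formula.toType, ih]
  | L1_congr B _ ih => simp only [toFun, Formula.toType, ih]
  | L2_congr A _ ih => simp only [toFun, Formula.toType, ih]
  | pair_congr _ _ ih₁ ih₂ => simp only [toFun, Formula.toType, ih₁, ih₂]
  | copair_congr _ _ ih₁ ih₂ => simp only [toFun, Formula.toType, ih₁, ih₂]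
  | cur_congr h _ ih => simp only [toFun, Formula.toType, ih]
  | comp_copair g f₁ f₂ => funext x; rcases x with x | x <;> rfl
  | copair_eta A B => funext x; rcases x with x | x <;> rfl
  | l_eta h f => funext x; exact Empty.elim x
  | dist_undist h A B C => funext x; rcases x with x | x <;> rfl
  | undist_dist h A B C => funext x; rcases x with ⟨x, y | y⟩ <;> rfl
  | dist_zero h hu A => funext x; exact Empty.elim x.2
  | _ => rfl

/-- The category of sets with cartesian products and disjoint unions. -/
def typeProductsSums : BinaryProductsSums Type where
  prod := Types.binaryProductLimitCone
  sum := Types.binaryCoproductColimitCocone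

/-- The two interpretations of `×,+`-formulae in sets agree. -/
def Formula.objEquiv (c : Calculus) (a : L → Type) :
    (A : Formula .timesPlus L) → typeProductsSums.obj a A ≃ (A.incl c).toType a
  | .letter _ => Equiv.refl _
  | .one h => h.elim
  | .zero h => h.elim
  | .prod A B => Equiv.prodCongr (objEquiv c a A) (objEquiv c a B)
  | .sum A B => Equiv.sumCongr (objEquiv c a A) (objEquiv c a B)
  | .exp h _ _ => h.elim

theorem Term.objEquiv_arrow (c : Calculus) (a : L → Type) {A B : Formula .timesPlus L}
    (f : Term A B) (x : typeProductsSums.obj a A) :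
    B.objEquiv c a (typeProductsSums.arrow a f x) = (f.incl c).toFun a (A.objEquiv c a x) := by
  induction f with
  | id A => rfl
  | comp g f ihg ihf => exact (ihg _).trans (congrArg _ (ihf x))
  | K1 B f ih => exact ih x.1
  | K2 A f ih => exact ih x.2
  | L1 B f ih => exact congrArg Sum.inl (ih x)
  | L2 A f ih => exact congrArg Sum.inr (ih x)
  | pair f g ihf ihg => exact Prod.ext (ihf x) (ihg x)
  | copair f g ihf ihg =>
    rcases x with x | x
    · exact ihf x
    · exact ihg x
  | k h => exact h.elim
  | l h => exact h.elim
  | dist h => exact h.elim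
  | ev h => exact h.elim
  | cur h => exact h.elim

theorem not_isThin_type : ¬ Quiver.IsThin Type := fun h => by
  have := (h Bool Bool).elim (TypeCat.ofHom fun _ => true) (TypeCat.ofHom fun _ => false)
  exact Bool.noConfusion (congrArg (fun f : Bool ⟶ Bool => f true) this)

/-- Sets model the calculus `c` and are not a preorder. A `×,+`-equation provable in `c` therefore
holds in sets, and maximality makes it provable without the extra structure. -/
theorem eqn_incl_iff (c : Calculus) {A B : Formula .timesPlus L} (f g : Term A B) :
    Eqn (f.incl c) (g.incl c) ↔ Eqn f g := by
  refine ⟨fun e => (typeProductsSums.holds_iff_eqn not_isThin_type f g).1 fun a => ?_,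
    Eqn.incl c⟩
  ext x
  apply (B.objEquiv c a).injective
  exact (objEquiv_arrow c a f x).trans
    ((congrFun (e.toFun_eq a) _).trans (objEquiv_arrow c a g x).symm)

theorem inclusion_faithful (c : Calculus) : (inclusion c L).Faithful where
  map_injective {A B} f g h := by
    induction f using Quotient.inductionOn with
    | h f =>
      induction g using Quotient.inductionOn with
      | h g => exact Quotient.sound ((eqn_incl_iff c f g).1 (Quotient.exact h))

/-- The two injections `I → I + I` denote different functions from a singleton to a two-element set;
no letters are needed. -/
theorem not_isThin_free (hu : c.HasUnits) : ¬ Quiver.IsThin (Free c L) := fun h => by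
  let s : Term (.one hu) (.sum (.one hu) (.one hu)) := .L1 (L := L) _ (.id _)
  let t : Term (.one hu) (.sum (.one hu) (.one hu)) := .L2 (L := L) _ (.id _)
  have e : Eqn s t := Quotient.exact
    ((h (Formula.one (L := L) hu) (.sum (.one hu) (.one hu))).elim
      (Quotient.mk (termSetoid _ _) s) (Quotient.mk (termSetoid _ _) t))
  exact Sum.inl_ne_inr (congrFun (e.toFun_eq fun _ => Unit) ())

end Sets

end Bicart

theorem mainTheorem7 (L : Type w) :
    -- the free category with binary products and sums is a full subcategory of the free
    -- bicartesian category, its objects being the formulae built with products and sums only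
    ((Bicart.inclusion .bicartesian L).Full ∧ (Bicart.inclusion .bicartesian L).Faithful ∧
      Function.Injective (Bicart.inclusion .bicartesian L).obj ∧
      Set.range (Bicart.inclusion .bicartesian L).obj =
        {A | Bicart.Formula.IsTimesPlus (c := .bicartesian) (L := L) A}) ∧
    -- conservativity of every category with binary products and sums that is not a preorder
    (∀ (𝓑 : Type u) [CategoryTheory.Category.{v} 𝓑] (S : Bicart.BinaryProductsSums 𝓑),
      ¬ Quiver.IsThin 𝓑 →
      ∀ (A B : Bicart.Formula .timesPlus L) (f g : Bicart.Term A B),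
        S.Holds f g ↔ Bicart.Eqn f g) ∧
    -- the free bicartesian, distributive bicartesian and bicartesian closed categories are not
    -- preorders, and the equations provable in them are conservative
    (∀ c : Bicart.Calculus, c = .bicartesian ∨ c = .distributive ∨ c = .closed →
      ¬ Quiver.IsThin (Bicart.Free c L) ∧
      ∀ (A B : Bicart.Formula .timesPlus L) (f g : Bicart.Term A B),
        Bicart.Eqn (f.incl c) (g.incl c) ↔ Bicart.Eqn f g) := by
  refine ⟨⟨Bicart.inclusion_full _ id id, Bicart.inclusion_faithful _,
    Bicart.inclusion_obj_injective _, Bicart.range_inclusion_obj _⟩,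
    fun 𝓑 _ S h𝓑 A B f g => S.holds_iff_eqn h𝓑 f g,
    fun c hc => ⟨?_, fun A B f g => Bicart.eqn_incl_iff c f g⟩⟩
  rcases hc with rfl | rfl | rfl <;> exact Bicart.not_isThin_free trivial
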